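/- Let $R$ be a commutative Noetherian ring and let $F = (0 \to F_b \to F_{b-1} \to \cdots \to F_a \to 0)$ be a finite free $R$-complex, i.e. a bounded complex of free $R$-modules of finite rank, with $F_i$ in homological degree $i$ $(i\in\mathbb Z)$. Let $\operatorname{Hom}_R(F,R)$ be the dual complex, with $\operatorname{Hom}_R(F_{-n},R)$ in homological degree $n$. For an $R$-complex $X$ define its dimension by $$\dim_R X = \sup\{\dim(R/\mathfrak p) - \inf \operatorname{H}(X)_{\mathfrak p} \mid \mathfrak p\in\operatorname{Spec} R\},$$ where $\inf \operatorname{H}(X)_{\mathfrak p} = \inf\{n\in\mathbb Z \mid \operatorname{H}_n(X)_{\mathfrak p}\neq 0\}$, and put $\sup \operatorname{H}(X) = \sup\{n\in\mathbb Z\mid \operatorname{H}_n(X)\ne 0\}$. Here $\dim$ of a ring is its Krull dimension (possibly $\infty$, and $-\infty$ for the zero ring), $\inf\varnothing=+\infty$, $\sup\varnothing=-\infty$, and all values are taken in $[-\infty,\infty]$ with $\infty+(-\infty)=\infty-\infty=-\infty$. Then $$\dim_R \operatorname{Hom}_R(F,R) \le \dim R + \sup \operatorname{H}(F).$$ -/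

import Mathlib

open scoped ENNReal

universe u v

noncomputable section

namespace FiniteFreeComplex

/-- The Krull dimension of a ring as an extended real number: `⊥` for the zero ring, `⊤` if there
are arbitrarily long chains of primes, and a natural number otherwise. -/
def krullDimE (A : Type u) [CommRing A] : EReal :=
  WithBot.recBotCoe (⊥ : EReal) (fun d : ℕ∞ => ((d : ℝ≥0∞) : EReal)) (ringKrullDim A)

variable {R : Type u} [CommRing R]

/-- `sup H(X)`, the supremum of the degrees in which the homology of `X` is nonzero
(`⊥` if `X` is acyclic). -/
def supH (X : ChainComplex (ModuleCat.{v} R) ℤ) : EReal :=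
  sSup {e : EReal | ∃ n : ℤ, Nontrivial (X.homology n) ∧ e = ((n : ℝ) : EReal)}

/-- `inf H(X)_𝔭`, the infimum of the degrees in which the homology of `X` localized at the
prime `𝔭` is nonzero (`⊤` if `H(X)_𝔭 = 0`). -/
def infHAt (X : ChainComplex (ModuleCat.{v} R) ℤ) (p : PrimeSpectrum R) : EReal :=
  sInf {e : EReal | ∃ n : ℤ,
    Nontrivial (LocalizedModule p.asIdeal.primeCompl (X.homology n)) ∧ e = ((n : ℝ) : EReal)}

/-- Foxby's dimension of a complex of `R`-modules,
`dim_R X = sup {dim (R/𝔭) - inf H(X)_𝔭 | 𝔭 ∈ Spec R}`.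
In `EReal` one has `⊤ - ⊤ = ⊥`, so primes with `H(X)_𝔭 = 0` contribute `⊥`. -/
def dim (X : ChainComplex (ModuleCat.{v} R) ℤ) : EReal :=
  ⨆ p : PrimeSpectrum R, krullDimE (R ⧸ p.asIdeal) - infHAt X p

/-- A finite free complex: a bounded complex of free modules of finite rank. -/
structure IsFiniteFree (F : ChainComplex (ModuleCat.{v} R) ℤ) : Prop where
  bounded : ∃ a b : ℤ, ∀ n : ℤ, n < a ∨ b < n → Subsingleton (F.X n)
  free : ∀ n : ℤ, Module.Free R (F.X n)
  finite : ∀ n : ℤ, Module.Finite R (F.X n)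

/-- The dual complex `Hom_R(F, R)`: in degree `n` it is `Hom_R(F_{-n}, R)`, with differential
`Hom_R(∂_{1-n}, R) : Hom_R(F_{-n}, R) → Hom_R(F_{1-n}, R)`. -/
def dual (F : ChainComplex (ModuleCat.{v} R) ℤ) :
    ChainComplex (ModuleCat.{max u v} R) ℤ where
  X n := ModuleCat.of R (F.X (-n) →ₗ[R] R)
  d i j := ModuleCat.ofHom (LinearMap.lcomp R R (F.d (-j) (-i)).hom)
  shape i j h := by
    have h0 : F.d (-j) (-i) = 0 := F.shape _ _ fun h' => h (by
      simp only [ComplexShape.down_Rel] at h' ⊢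
      omega)
    rw [h0]
    ext f x
    simp
  d_comp_d' i j k _ _ := by
    have h0 := F.d_comp_d (-k) (-j) (-i)
    ext f x
    have h1 := congrArg (fun g => g.hom x) h0
    simp only [ModuleCat.hom_comp, LinearMap.comp_apply] at h1
    simp [h1]

end FiniteFreeComplex

end

/-! The heart is the local bound `inf H(Hom(F, R))_𝔭 ≥ -(ht 𝔭 + sup H(F))`; combined with `dim R/𝔭 +
ht 𝔭 ≤ dim R` it gives the theorem. For an integer `s ≥ sup H(F)`, the part of `F` in degrees `≥ s`
is a bounded free resolution of a module `C`, and the bound amounts to `Ext^i(C, R)_𝔭 = 0` for `i >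
ht 𝔭`. As in the Auslander–Buchsbaum theorem, over a local ring of dimension at most `d` such a
resolution splits from step `d` on.

Splitting is encoded by `D B D = D` and propagates down from the zero end of the resolution
(`ExactSeq.exists_pseudoinverse`). The inductive step needs `D k` to be injective modulo the maximal
ideal on a complement of the image of `D (k + 1)` (`ExactSeq.mem_maximalIdeal_of_mulVec_mem`). This
goes by induction on the dimension: either divide by a nonzerodivisor in the maximal ideal, or use a
nonzero element killed by that ideal. -/

namespace FiniteFreeComplex

open Matrix IsLocalRing

/-! ### Exact matrix sequences, their quotients and localizations -/

/-- A sequence of matrices `⋯ → A ^ n₂ → A ^ n₁ → A ^ n₀` which is a complex, exact except possibly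
at `A ^ n₀`. -/
def ExactSeq {A : Type*} [CommRing A] (n : ℕ → ℕ)
    (D : ∀ i, Matrix (Fin (n i)) (Fin (n (i + 1))) A) : Prop :=
  (∀ i, D i * D (i + 1) = 0) ∧
    ∀ i (v : Fin (n (i + 1)) → A), D i *ᵥ v = 0 → ∃ w, v = D (i + 1) *ᵥ w

lemma exists_smul_eq_algebraMap_comp {A L : Type*} [CommRing A] [CommRing L] [Algebra A L]
    (S : Submonoid A) [IsLocalization S L] {ι : Type*} [Finite ι] (v : ι → L) :
    ∃ t ∈ S, ∃ u : ι → A, t • v = algebraMap A L ∘ u := by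
  obtain ⟨t, ht⟩ := IsLocalization.exist_integer_multiples_of_finite S v
  choose u hu using ht
  exact ⟨t, t.2, u, funext fun i => (hu i).symm⟩

lemma exists_smul_eq_smul_of_algebraMap_comp_eq {A L : Type*} [CommRing A] [CommRing L]
    [Algebra A L] (S : Submonoid A) [IsLocalization S L] {ι : Type*} [Fintype ι] {u w : ι → A}
    (h : algebraMap A L ∘ u = algebraMap A L ∘ w) : ∃ t ∈ S, t • u = t • w := by
  classical
  have h1 : ∀ i, ∃ c : S, c * u i = c * w i := fun i => IsLocalization.exists_of_eq (congrFun h i)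
  choose c hc using h1
  refine ⟨∏ i, (c i : A), prod_mem fun i _ => (c i).2, ?_⟩
  ext i
  rw [Pi.smul_apply, Pi.smul_apply, ← Finset.prod_erase_mul _ _ (Finset.mem_univ i), smul_eq_mul,
    smul_eq_mul, mul_assoc, mul_assoc, hc]

/-- In a Noetherian local ring, either the maximal ideal contains a nonzerodivisor or it
annihilates a nonzero element. -/
lemma exists_mem_nonZeroDivisors_or_exists_annihilated (A : Type*) [CommRing A]
    [IsNoetherianRing A] [IsLocalRing A] :
    (∃ r ∈ maximalIdeal A, r ∈ nonZeroDivisors A) ∨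
      ∃ e : A, e ≠ 0 ∧ ∀ a ∈ maximalIdeal A, e * a = 0 := by
  by_cases h : Disjoint (maximalIdeal A : Set A) (nonZeroDivisors A)
  · obtain ⟨e, he, he0⟩ :=
      Submodule.exists_mem_ne_zero_of_ne_bot
        (Ideal.bot_lt_annihilator_of_disjoint_nonZeroDivisors h).ne'
    exact Or.inr ⟨e, he0, Submodule.mem_annihilator.1 he⟩
  · obtain ⟨r, hr, hr'⟩ := Set.not_disjoint_iff.1 h
    exact Or.inl ⟨r, hr, hr'⟩

namespace ExactSeq

variable {A : Type*} [CommRing A] {n : ℕ → ℕ} {D : ∀ i, Matrix (Fin (n i)) (Fin (n (i + 1))) A}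

lemma exists_eq_mul (h : ExactSeq n D) {i m : ℕ} (M : Matrix (Fin (n (i + 1))) (Fin m) A)
    (hM : D i * M = 0) : ∃ W : Matrix (Fin (n (i + 1 + 1))) (Fin m) A, M = D (i + 1) * W := by
  have h1 : ∀ j, ∃ w, M.col j = D (i + 1) *ᵥ w := fun j => h.2 i _ <| by
    ext a
    exact congrFun (congrFun hM a) j
  choose W hW using h1
  refine ⟨(Matrix.of W)ᵀ, ?_⟩
  ext a j
  exact congrFun (hW j) a

/-- Reducing an exact sequence modulo a nonzerodivisor yields a sequence that is exact after
dropping its last term. -/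
lemma quotient (h : ExactSeq n D) {r : A} (hr : r ∈ nonZeroDivisors A) :
    ExactSeq (fun i => n (i + 1))
      (fun i => (D (i + 1)).map (Ideal.Quotient.mk (Ideal.span {r}))) := by
  refine ⟨fun i => ?_, fun i v hv => ?_⟩
  · have h1 := h.1 (i + 1)
    rw [← Matrix.map_mul, h1]
    simp
  · obtain ⟨v, rfl⟩ : ∃ u, v = Ideal.Quotient.mk (Ideal.span {r}) ∘ u := by
      choose u hu using fun j => Ideal.Quotient.mk_surjective (v j)
      exact ⟨u, funext fun j => (hu j).symm⟩
    have h1 : ∀ a, ∃ z, (D (i + 1) *ᵥ v) a = r * z := fun a => by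
      have := congrFun hv a
      rw [← RingHom.map_mulVec, Pi.zero_apply, Ideal.Quotient.eq_zero_iff_mem,
        Ideal.mem_span_singleton] at this
      exact this
    choose z hz using h1
    have hz : D (i + 1) *ᵥ v = r • z := funext hz
    have h2 : D i *ᵥ z = 0 := by
      have h3 : r • (D i *ᵥ z) = 0 := by
        rw [← mulVec_smul, ← hz, mulVec_mulVec, h.1, zero_mulVec]
      ext a
      have h4 := congrFun h3 a
      simp only [Pi.smul_apply, smul_eq_mul, Pi.zero_apply] at h4
      exact (mul_left_mem_nonZeroDivisors_eq_zero_iff hr).1 h4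
    -- Exactness one place lower, at the term that is dropped, lets the lift `v` be corrected to a
    -- genuine cycle `v - r • w`.
    obtain ⟨w, hw⟩ := h.2 i z h2
    obtain ⟨u, hu⟩ := h.2 (i + 1) (v - r • w) (by rw [mulVec_sub, mulVec_smul, ← hw, hz, sub_self])
    refine ⟨Ideal.Quotient.mk (Ideal.span {r}) ∘ u, ?_⟩
    ext a
    rw [← RingHom.map_mulVec, ← hu, Function.comp_apply, Ideal.Quotient.eq,
      Ideal.mem_span_singleton]
    exact ⟨w a, by simp⟩

/-- Exactness is preserved by localization. -/
lemma localization (h : ExactSeq n D) (S : Submonoid A) (L : Type*) [CommRing L] [Algebra A L]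
    [IsLocalization S L] : ExactSeq n (fun i => (D i).map (algebraMap A L)) := by
  refine ⟨fun i => ?_, fun i v hv => ?_⟩
  · rw [← Matrix.map_mul, h.1]
    simp
  · obtain ⟨t, ht, u, hu⟩ := exists_smul_eq_algebraMap_comp S v
    have h1 : algebraMap A L ∘ (D i *ᵥ u) = algebraMap A L ∘ (0 : Fin (n i) → A) := by
      ext a
      rw [Function.comp_apply, RingHom.map_mulVec, ← hu, mulVec_smul, hv]
      simp
    obtain ⟨c, hc, hcu⟩ := exists_smul_eq_smul_of_algebraMap_comp_eq S h1
    obtain ⟨w, hw⟩ := h.2 i (c • u) (by rw [mulVec_smul, hcu, smul_zero])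
    have hct : IsUnit (algebraMap A L (c * t)) := IsLocalization.map_units L ⟨c * t, mul_mem hc ht⟩
    obtain ⟨q, hq⟩ := hct.exists_left_inv
    refine ⟨q • (algebraMap A L ∘ w), ?_⟩
    have h2 : algebraMap A L (c * t) • v = (D (i + 1)).map (algebraMap A L) *ᵥ
        (algebraMap A L ∘ w) := by
      ext a
      rw [← RingHom.map_mulVec, ← hw, algebraMap_smul, mul_smul, hu]
      simp [Algebra.smul_def]
    rw [mulVec_smul, ← h2, smul_smul, hq, one_smul]

/-! ### Splitting over a local ring -/

/-- A matrix in an exact sequence over a local ring is, up to the kernel, injective modulo the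
maximal ideal if that ideal annihilates a nonzero element. -/
lemma mem_maximalIdeal_of_annihilated [IsLocalRing A] (h : ExactSeq n D) {e : A} (he : e ≠ 0)
    (hm : ∀ a ∈ maximalIdeal A, e * a = 0) {k : ℕ}
    {B : Matrix (Fin (n (k + 1 + 1))) (Fin (n (k + 1))) A}
    (hB : D (k + 1) * B * D (k + 1) = D (k + 1)) {v : Fin (n (k + 1)) → A}
    (hv : ∀ i, (D k *ᵥ v) i ∈ maximalIdeal A) (i : Fin (n (k + 1))) :
    ((1 - D (k + 1) * B) *ᵥ v) i ∈ maximalIdeal A := by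
  -- `e` kills `D k *ᵥ v`, so `e • v` is a boundary and the projection `1 - D (k + 1) * B` kills it;
  -- entries annihilated by `e ≠ 0` are not units.
  obtain ⟨w, hw⟩ := h.2 k (e • v) <| by
    ext a
    rw [mulVec_smul]
    exact hm _ (hv a)
  have h1 : e • ((1 - D (k + 1) * B) *ᵥ v) = 0 := by
    rw [← mulVec_smul, hw, mulVec_mulVec, Matrix.sub_mul, hB, Matrix.one_mul, sub_self, zero_mulVec]
  rw [mem_maximalIdeal, mem_nonunits_iff]
  exact fun hu => he (hu.mul_left_eq_zero.1 (congrFun h1 i))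

/-- A matrix in an exact sequence over a local ring that lies far enough to the left is, up to the
kernel, injective modulo the maximal ideal. -/
theorem mem_maximalIdeal_of_mulVec_mem (d : ℕ) : ∀ {A : Type u} [CommRing A] [IsNoetherianRing A]
    [IsLocalRing A], ringKrullDim A ≤ d → ∀ {n : ℕ → ℕ}
    {D : ∀ i, Matrix (Fin (n i)) (Fin (n (i + 1))) A}, ExactSeq n D → ∀ {k : ℕ}, d ≤ k →
    ∀ {B : Matrix (Fin (n (k + 1 + 1))) (Fin (n (k + 1))) A},
    D (k + 1) * B * D (k + 1) = D (k + 1) → ∀ {v : Fin (n (k + 1)) → A},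
    (∀ i, (D k *ᵥ v) i ∈ maximalIdeal A) →
    ∀ i, ((1 - D (k + 1) * B) *ᵥ v) i ∈ maximalIdeal A := by
  induction d with
  | zero =>
    intro A _ _ _ hd n D h k _ B hB v hv
    obtain ⟨r, hr, hr'⟩ | ⟨e, he, hm⟩ := exists_mem_nonZeroDivisors_or_exists_annihilated A
    · have : Nontrivial (A ⧸ Ideal.span {r}) := Ideal.Quotient.nontrivial_iff.2 fun h1 =>
        (mem_nonunits_iff.1 ((mem_maximalIdeal r).1 hr)) (Ideal.span_singleton_eq_top.1 h1)
      have h1 := (ringKrullDim_quotient_succ_le_of_nonZeroDivisor hr').trans hd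
      have h2 := ringKrullDim_nonneg_of_nontrivial (R := A ⧸ Ideal.span {r})
      have h3 : (1 : WithBot ℕ∞) ≤ 0 := (le_add_of_nonneg_left h2).trans h1
      exact absurd h3 (by simp)
    · exact h.mem_maximalIdeal_of_annihilated he hm hB hv
  | succ d ih =>
    intro A _ _ _ hd n D h k hk B hB v hv
    obtain ⟨r, hr, hr'⟩ | ⟨e, he, hm⟩ := exists_mem_nonZeroDivisors_or_exists_annihilated A
    · have : Nontrivial (A ⧸ Ideal.span {r}) := Ideal.Quotient.nontrivial_iff.2 fun h1 =>
        (mem_nonunits_iff.1 ((mem_maximalIdeal r).1 hr)) (Ideal.span_singleton_eq_top.1 h1)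
      let π := Ideal.Quotient.mk (Ideal.span {r})
      have hloc : IsLocalRing (A ⧸ Ideal.span {r}) :=
        IsLocalRing.of_surjective' π Ideal.Quotient.mk_surjective
      have hπ : ∀ a, π a ∈ maximalIdeal (A ⧸ Ideal.span {r}) ↔ a ∈ maximalIdeal A := by
        have : IsLocalHom π := IsLocalHom.of_surjective π Ideal.Quotient.mk_surjective
        intro a
        simp [mem_maximalIdeal, mem_nonunits_iff]
      have hd' : ringKrullDim (A ⧸ Ideal.span {r}) ≤ d := by
        have h1 := (ringKrullDim_quotient_succ_le_of_nonZeroDivisor hr').trans hd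
        rw [Nat.cast_succ] at h1
        revert h1
        cases ringKrullDim (A ⧸ Ideal.span {r}) with
        | bot => simp
        | coe a =>
          intro h1
          have h2 : a + 1 ≤ d + 1 := by exact_mod_cast h1
          have h3 : a ≤ d := (ENat.add_le_add_iff_right ENat.one_ne_top).1 h2
          exact_mod_cast h3
      -- Modulo `r` the index of each matrix drops by one, and so does the bound on the dimension;
      -- hence `d ≤ k` persists.
      obtain ⟨k, rfl⟩ : ∃ l, k = l + 1 := ⟨k - 1, by omega⟩
      intro i
      have h1 := ih hd' (h.quotient hr') (k := k) (by omega) (B := B.map π)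
        (by rw [← Matrix.map_mul, ← Matrix.map_mul, hB]) (v := π ∘ v)
        (fun i => by
          rw [← RingHom.map_mulVec]
          exact (hπ _).2 (hv i)) i
      rw [← Matrix.map_mul, ← Matrix.map_one π (map_zero π) (map_one π),
        ← Matrix.map_sub π (map_sub π), ← RingHom.map_mulVec] at h1
      exact (hπ _).1 h1
    · exact h.mem_maximalIdeal_of_annihilated he hm hB hv

/-- Over a field, a matrix whose kernel contains that of `M` is a left multiple of `M`. -/
lemma _root_.Matrix.exists_eq_mul_of_mulVec_eq_zero {K : Type*} [Field K] {l m p : ℕ}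
    (M : Matrix (Fin l) (Fin m) K) (Q : Matrix (Fin p) (Fin m) K)
    (h : ∀ v, M *ᵥ v = 0 → Q *ᵥ v = 0) : ∃ C : Matrix (Fin p) (Fin l) K, Q = C * M := by
  obtain ⟨g, hg⟩ := M.mulVecLin.rangeRestrict.exists_rightInverse_of_surjective
    M.mulVecLin.range_rangeRestrict
  obtain ⟨G, hG⟩ := g.exists_extend
  have h1 : ∀ v, M *ᵥ G (M *ᵥ v) = M *ᵥ v := fun v => by
    have h2 := LinearMap.congr_fun hG (M.mulVecLin.rangeRestrict v)
    have h3 := congrArg Subtype.val (LinearMap.congr_fun hg (M.mulVecLin.rangeRestrict v))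
    simp only [LinearMap.comp_apply] at h2 h3
    rw [← h2] at h3
    exact h3
  refine ⟨Q * LinearMap.toMatrix' G, Matrix.ext_of_mulVec_single fun j => ?_⟩
  rw [← mulVec_mulVec, ← mulVec_mulVec, LinearMap.toMatrix'_mulVec, ← sub_eq_zero, ← mulVec_sub]
  exact h _ (by rw [mulVec_sub, h1, sub_self])

/-- Far enough to the left, a matrix of a bounded exact sequence over a local ring has a
pseudo-inverse if its predecessor has. -/
lemma exists_pseudoinverse_of_succ {A : Type u} [CommRing A] [IsNoetherianRing A]
    [IsLocalRing A] {d : ℕ} (hd : ringKrullDim A ≤ d) {n : ℕ → ℕ}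
    {D : ∀ i, Matrix (Fin (n i)) (Fin (n (i + 1))) A} (h : ExactSeq n D) {k : ℕ} (hk : d ≤ k)
    (hB : ∃ B : Matrix (Fin (n (k + 1 + 1))) (Fin (n (k + 1))) A,
      D (k + 1) * B * D (k + 1) = D (k + 1)) :
    ∃ B : Matrix (Fin (n (k + 1))) (Fin (n k)) A, D k * B * D k = D k := by
  obtain ⟨B, hB⟩ := hB
  -- `Q` is the projection along the image of `D (k + 1)`, which is the kernel of `D k`.
  set Q := 1 - D (k + 1) * B with hQ
  have hDQ : D k * Q = D k := by
    rw [hQ, Matrix.mul_sub, ← Matrix.mul_assoc, h.1, Matrix.zero_mul, sub_zero, Matrix.mul_one]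
  have hQQ : Q * Q = Q := by
    have : D (k + 1) * B * (D (k + 1) * B) = D (k + 1) * B := by rw [← Matrix.mul_assoc, hB]
    rw [hQ, Matrix.sub_mul, Matrix.mul_sub, Matrix.mul_sub, this]
    simp
  obtain ⟨C', hC'⟩ := Matrix.exists_eq_mul_of_mulVec_eq_zero ((D k).map (residue A))
    (Q.map (residue A)) fun v hv => by
      obtain ⟨v, rfl⟩ : ∃ u, v = residue A ∘ u := by
        choose u hu using fun j => residue_surjective (v j)
        exact ⟨u, funext fun j => (hu j).symm⟩
      ext i
      rw [← RingHom.map_mulVec, Pi.zero_apply, residue_eq_zero_iff]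
      refine mem_maximalIdeal_of_mulVec_mem d hd h hk hB (fun j => ?_) i
      rw [← residue_eq_zero_iff, RingHom.map_mulVec, hv, Pi.zero_apply]
  obtain ⟨C, rfl⟩ : ∃ C : Matrix (Fin (n (k + 1))) (Fin (n k)) A, C' = C.map (residue A) := by
    choose C hC using fun i j => residue_surjective (C' i j)
    exact ⟨Matrix.of C, by ext i j; exact (hC i j).symm⟩
  -- `N` vanishes over the residue field, so `1 - N` is invertible; then `(1 - N) * Q = C * D k`
  -- exhibits `Q` as a left multiple of `D k`.
  set N := Q - C * D k with hN
  have hu : IsUnit (1 - N) := by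
    rw [Matrix.isUnit_iff_isUnit_det, ← isUnit_map_iff (residue A), RingHom.map_det,
      RingHom.mapMatrix_apply, Matrix.map_sub _ (map_sub _), hN, Matrix.map_sub _ (map_sub _),
      Matrix.map_mul, hC']
    simp
  obtain ⟨U, hU⟩ := hu.exists_left_inv
  have h1 : (1 - N) * Q = C * D k := by
    rw [Matrix.sub_mul, hN, Matrix.sub_mul, hQQ, Matrix.mul_assoc, hDQ]
    simp
  refine ⟨U * C, ?_⟩
  rw [Matrix.mul_assoc, Matrix.mul_assoc, ← h1, ← Matrix.mul_assoc U, hU, Matrix.one_mul, hDQ]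

/-- Descending induction from the zero matrices beyond `c`. For `k = d` this says that the cokernel
of `D 0` has projective dimension at most `d`. -/
theorem exists_pseudoinverse {A : Type u} [CommRing A] [IsNoetherianRing A]
    [IsLocalRing A] {d : ℕ} (hd : ringKrullDim A ≤ d) {n : ℕ → ℕ}
    {D : ∀ i, Matrix (Fin (n i)) (Fin (n (i + 1))) A} (h : ExactSeq n D) {c : ℕ}
    (hc : ∀ i, c ≤ i → n i = 0) {k : ℕ} (hk : d ≤ k) :
    ∃ B : Matrix (Fin (n (k + 1))) (Fin (n k)) A, D k * B * D k = D k := by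
  obtain hck | hkc := le_total c k
  · have := hc k hck
    refine ⟨0, ?_⟩
    ext i
    exact (Fin.cast this i).elim0
  · induction hkc using Nat.decreasingInduction with
    | self =>
      refine ⟨0, ?_⟩
      ext i
      exact (Fin.cast (hc c le_rfl) i).elim0
    | of_succ k hkc ih => exact h.exists_pseudoinverse_of_succ hd hk (ih (by omega))

/-! ### Local vanishing for the dual complex -/

/-- The dual of a bounded exact sequence of finite free modules has cohomology vanishing locally
at a prime beyond the height of that prime. -/
theorem exists_smul_eq_vecMul {R : Type u} [CommRing R] [IsNoetherianRing R] {p : Ideal R}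
    [p.IsPrime] {d : ℕ} (hd : p.height ≤ d) {n : ℕ → ℕ}
    {D : ∀ i, Matrix (Fin (n i)) (Fin (n (i + 1))) R} (h : ExactSeq n D) {c : ℕ}
    (hc : ∀ i, c ≤ i → n i = 0) {k : ℕ} (hk : d ≤ k) {x : Fin (n (k + 1)) → R}
    (hx : x ᵥ* D (k + 1) = 0) : ∃ t ∈ p.primeCompl, ∃ y, t • x = y ᵥ* D k := by
  let L := Localization.AtPrime p
  let f := algebraMap R L
  have hL := h.localization p.primeCompl L
  have hdL : ringKrullDim L ≤ d := by
    rw [IsLocalization.AtPrime.ringKrullDim_eq_height p L]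
    exact_mod_cast hd
  have : IsNoetherianRing L := IsLocalization.isNoetherianRing p.primeCompl L inferInstance
  obtain ⟨B, hB⟩ := hL.exists_pseudoinverse hdL hc hk
  -- `1 - B * D k = D (k + 1) * W` is a contracting homotopy: a row vector killed by `D (k + 1)`
  -- equals its own product with `B * D k`.
  obtain ⟨W, hW⟩ := hL.exists_eq_mul (1 - B * (D k).map f) (by
    rw [Matrix.mul_sub, ← Matrix.mul_assoc, hB, Matrix.mul_one, sub_self])
  have h1 : f ∘ x = ((f ∘ x) ᵥ* B) ᵥ* (D k).map f := by
    have h2 : (f ∘ x) ᵥ* (1 - B * (D k).map f) = 0 := by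
      have h3 : (f ∘ x) ᵥ* (D (k + 1)).map f = 0 := by
        ext a
        rw [← RingHom.map_vecMul, hx]
        simp
      rw [hW, ← vecMul_vecMul, h3, zero_vecMul]
    rwa [vecMul_sub, vecMul_one, sub_eq_zero, ← vecMul_vecMul] at h2
  obtain ⟨t, ht, y, hy⟩ := exists_smul_eq_algebraMap_comp p.primeCompl ((f ∘ x) ᵥ* B)
  have h2 : f ∘ (t • x) = f ∘ (y ᵥ* D k) := by
    ext a
    rw [Function.comp_apply, Function.comp_apply, RingHom.map_vecMul, ← hy, smul_vecMul, ← h1]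
    simp [Algebra.smul_def, f]
  obtain ⟨c, hc, h3⟩ := exists_smul_eq_smul_of_algebraMap_comp_eq p.primeCompl h2
  exact ⟨c * t, mul_mem hc ht, c • y, by rw [mul_smul, h3, smul_vecMul]⟩

end ExactSeq

open CategoryTheory in
lemma exists_d_eq_of_subsingleton_homology {R : Type u} [CommRing R]
    (X : ChainComplex (ModuleCat.{v} R) ℤ) {i j k : ℤ} (hi : j + 1 = i) (hk : k + 1 = j)
    (h : Subsingleton (X.homology j)) (x : X.X j) (hx : X.d j k x = 0) : ∃ y, X.d i j y = x := by
  have h1 : X.ExactAt j := (X.exactAt_iff_isZero_homology j).2 (ModuleCat.isZero_of_subsingleton _)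
  rw [X.exactAt_iff' i j k (by simp [hi]) (by simp [← hk])] at h1
  exact (ShortComplex.moduleCat_exact_iff _).1 h1 x hx

open CategoryTheory in
/-- The localized homology vanishes if every cycle becomes a boundary after multiplication by an
element of the multiplicative set. -/
lemma subsingleton_localizedModule_homology {R : Type u} [CommRing R] (S : Submonoid R)
    (X : ChainComplex (ModuleCat.{v} R) ℤ) {i j k : ℤ}
    (h : ∀ x : X.X j, X.d j k x = 0 → ∃ t ∈ S, ∃ y, X.d i j y = t • x) :
    Subsingleton (LocalizedModule S (X.homology j)) := by
  rw [LocalizedModule.subsingleton_iff]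
  intro z
  obtain ⟨c, rfl⟩ := (ModuleCat.epi_iff_surjective (X.homologyπ j)).1 inferInstance z
  obtain ⟨t, ht, y, hy⟩ := h (X.iCycles j c) (by
    rw [← ModuleCat.comp_apply, X.iCycles_d]
    simp)
  refine ⟨t, ht, ?_⟩
  have h1 : X.toCycles i j y = t • c := by
    apply (ModuleCat.mono_iff_injective (X.iCycles j)).1 inferInstance
    rw [← ModuleCat.comp_apply, X.toCycles_i, hy, map_smul]
  rw [← map_smul, ← h1, ← ModuleCat.comp_apply, X.toCycles_comp_homologyπ]
  simp

lemma vecMul_toMatrix_apply {R M N ι κ : Type*} [CommRing R] [AddCommGroup M] [Module R M]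
    [AddCommGroup N] [Module R N] [Fintype ι] [Fintype κ] [DecidableEq κ] (b : Module.Basis κ R N)
    (b' : Module.Basis ι R M) (f : N →ₗ[R] M) (ψ : M →ₗ[R] R) (c : κ) :
    ((fun a => ψ (b' a)) ᵥ* LinearMap.toMatrix b b' f) c = ψ (f (b c)) := by
  conv_rhs => rw [← b'.sum_repr (f (b c)), map_sum]
  simp [Matrix.vecMul, dotProduct, LinearMap.toMatrix_apply, mul_comm]

/-- If `H_j(F) = 0` for all `j > s`, then `H_m(Hom(F, R))_𝔭 = 0` for all `m < -(ht 𝔭 + s)`. -/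
theorem subsingleton_localizedModule_homology_dual {R : Type u} [CommRing R] [IsNoetherianRing R]
    {F : ChainComplex (ModuleCat.{v} R) ℤ} (hF : IsFiniteFree F) {p : Ideal R} [p.IsPrime] {d : ℕ}
    (hd : p.height ≤ d) {s : ℤ} (hs : ∀ j, s < j → Subsingleton (F.homology j)) {m : ℤ}
    (hm : d + s < -m) : Subsingleton (LocalizedModule p.primeCompl ((dual F).homology m)) := by
  classical
  have := (Ideal.Quotient.mk p).domain_nontrivial
  have := hF.free
  have := hF.finite
  obtain ⟨a, b, hab⟩ := hF.bounded
  -- The double negation is what `dual F` produces in degree `-(s + i)`; keeping it avoids transport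
  -- between equal degrees.
  let n : ℕ → ℕ := fun i => Module.finrank R (F.X (- -(s + i)))
  let β : ∀ i : ℕ, Module.Basis (Fin (n i)) R (F.X (- -(s + i))) := fun i => Module.finBasis R _
  let D : ∀ i : ℕ, Matrix (Fin (n i)) (Fin (n (i + 1))) R := fun i =>
    LinearMap.toMatrix (β (i + 1)) (β i) (F.d (- -(s + (i + 1 : ℕ))) (- -(s + i))).hom
  have hD : ExactSeq n D := by
    refine ⟨fun i => ?_, fun i v hv => ?_⟩
    · rw [← LinearMap.toMatrix_comp, ← ModuleCat.hom_comp, F.d_comp_d]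
      simp
    · obtain ⟨x, rfl⟩ := (β (i + 1)).equivFun.surjective v
      have h1 : F.d (- -(s + (i + 1 : ℕ))) (- -(s + i)) x = 0 := by
        apply (β i).equivFun.injective
        rw [map_zero, ← hv]
        exact (LinearMap.toMatrix_mulVec_repr (β (i + 1)) (β i) _ x).symm
      obtain ⟨y, rfl⟩ := exists_d_eq_of_subsingleton_homology F (i := - -(s + (i + 1 + 1 : ℕ)))
        (by push_cast; ring) (by push_cast; ring) (hs _ (by push_cast; omega)) x h1
      exact ⟨(β (i + 1 + 1)).equivFun y,
        (LinearMap.toMatrix_mulVec_repr (β (i + 1 + 1)) (β (i + 1)) _ y).symm⟩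
  have hc : ∀ i, (b + 1 - s).toNat ≤ i → n i = 0 := fun i hi => by
    have := hab (- -(s + i)) (Or.inr (by omega))
    exact Module.finrank_zero_of_subsingleton
  -- Here `d + s < -m` becomes `d < k + 1`, that is, `d ≤ k`.
  obtain ⟨k, rfl⟩ : ∃ k : ℕ, m = -(s + (k + 1 : ℕ)) :=
    ⟨(-m - s - 1).toNat, by push_cast; omega⟩
  apply subsingleton_localizedModule_homology p.primeCompl (dual F)
    (i := -(s + k)) (k := -(s + (k + 1 + 1 : ℕ)))
  suffices H : ∀ φ : F.X (- -(s + (k + 1 : ℕ))) →ₗ[R] R,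
      φ ∘ₗ (F.d (- -(s + (k + 1 + 1 : ℕ))) (- -(s + (k + 1 : ℕ)))).hom = 0 →
      ∃ t ∈ p.primeCompl, ∃ ψ : F.X (- -(s + k)) →ₗ[R] R,
        ψ ∘ₗ (F.d (- -(s + (k + 1 : ℕ))) (- -(s + k))).hom = t • φ from H
  intro φ hφ
  obtain ⟨t, ht, y, hy⟩ := hD.exists_smul_eq_vecMul hd hc (k := k) (by omega)
    (x := fun a => φ (β (k + 1) a)) (by
      ext c
      rw [vecMul_toMatrix_apply, ← LinearMap.comp_apply, hφ]
      rfl)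
  refine ⟨t, ht, (β k).constr R y, (β (k + 1)).ext fun c => ?_⟩
  have h1 := vecMul_toMatrix_apply (β (k + 1)) (β k)
    (F.d (- -(s + (k + 1 : ℕ))) (- -(s + k))).hom ((β k).constr R y) c
  simp only [Module.Basis.constr_basis] at h1
  exact h1.symm.trans (congrFun hy c).symm

/-! ### Dimension estimates in extended values -/

/-- Chains of primes below `p` and above `p` concatenate; `dim R/p` is the coheight of `p` in the
spectrum. -/
lemma ringKrullDim_quotient_add_height_le {R : Type u} [CommRing R] (p : PrimeSpectrum R) :
    ringKrullDim (R ⧸ p.asIdeal) + p.asIdeal.height ≤ ringKrullDim R := by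
  have : Nonempty (PrimeSpectrum R) := ⟨p⟩
  have h1 : ringKrullDim (R ⧸ p.asIdeal) = Order.coheight p := by
    rw [ringKrullDim_quotient, Order.coheight_eq_krullDim_Ici]
    rfl
  rw [h1, p.height_eq_orderHeight, ringKrullDim,
    Order.krullDim_eq_iSup_height_add_coheight_of_nonempty, ← WithBot.coe_add, add_comm]
  exact WithBot.coe_le_coe.2 (le_iSup (fun q => Order.height q + Order.coheight q) p)

lemma krullDimE_quotient_add_height_le {R : Type u} [CommRing R] (p : PrimeSpectrum R) {d : ℕ}
    (hd : p.asIdeal.height = d) : krullDimE (R ⧸ p.asIdeal) + d ≤ krullDimE R := by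
  have h := ringKrullDim_quotient_add_height_le p
  rw [hd] at h
  unfold krullDimE
  cases h1 : ringKrullDim (R ⧸ p.asIdeal) with
  | bot => simp
  | coe a =>
    cases h2 : ringKrullDim R with
    | bot =>
      rw [h1, h2] at h
      simp at h
    | coe c =>
      rw [h1, h2] at h
      have h3 : a + d ≤ c := by exact_mod_cast h
      have h4 := EReal.coe_ennreal_le_coe_ennreal_iff.2 (ENat.toENNReal_le.2 h3)
      rw [ENat.toENNReal_add, EReal.coe_ennreal_add] at h4
      have h5 : (((d : ℕ∞) : ℝ≥0∞) : EReal) = d := by rw [ENat.toENNReal_coe]; rfl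
      rwa [h5] at h4

lemma bot_lt_krullDimE {R : Type u} [CommRing R] [Nontrivial R] : ⊥ < krullDimE R := by
  have := ringKrullDim_nonneg_of_nontrivial (R := R)
  unfold krullDimE
  cases h1 : ringKrullDim R with
  | bot => simp [h1] at this
  | coe a => exact bot_lt_iff_ne_bot.2 (EReal.coe_ennreal_ne_bot _)

/-- An arbitrary real upper bound `σ` replaces `supH F`, so that the acyclic case is covered by
letting `σ` tend to `-∞`. -/
lemma neg_le_infHAt_dual {R : Type u} [CommRing R] [IsNoetherianRing R]
    {F : ChainComplex (ModuleCat.{v} R) ℤ} (hF : IsFiniteFree F) (p : PrimeSpectrum R) {d : ℕ}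
    (hd : p.asIdeal.height ≤ d) {σ : ℝ} (hσ : supH F ≤ σ) :
    ((-(d + σ) : ℝ) : EReal) ≤ infHAt (dual F) p := by
  refine le_sInf ?_
  rintro _ ⟨m, hm, rfl⟩
  rw [EReal.coe_le_coe_iff]
  have hs : ∀ j, ⌊σ⌋ < j → Subsingleton (F.homology j) := fun j hj => by
    by_contra h
    rw [not_subsingleton_iff_nontrivial] at h
    have h1 : ((j : ℝ) : EReal) ≤ σ := (le_sSup ⟨j, h, rfl⟩ : _ ≤ supH F).trans hσ
    exact absurd (Int.le_floor.2 (EReal.coe_le_coe_iff.1 h1)) hj.not_ge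
  have h1 : ¬ (d + ⌊σ⌋ < -m) := fun h =>
    not_nontrivial_iff_subsingleton.2 (subsingleton_localizedModule_homology_dual hF hd hs h) hm
  have h2 : (-m : ℝ) ≤ d + ⌊σ⌋ := by exact_mod_cast not_lt.1 h1
  linarith [Int.floor_le σ]

end FiniteFreeComplex

theorem mainTheorem3 {R : Type u} [CommRing R] [IsNoetherianRing R]
    (F : ChainComplex (ModuleCat.{v} R) ℤ) (hF : FiniteFreeComplex.IsFiniteFree F) :
    FiniteFreeComplex.dim (FiniteFreeComplex.dual F) ≤
      FiniteFreeComplex.krullDimE R + FiniteFreeComplex.supH F := by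
  refine iSup_le fun p => ?_
  have : Nontrivial R := (Ideal.Quotient.mk p.asIdeal).domain_nontrivial
  obtain ⟨d, hd⟩ := ENat.ne_top_iff_exists.1 (Ideal.height_ne_top p.isPrime.ne_top)
  induction h : FiniteFreeComplex.supH F with
  | top =>
    -- Since `⊥ + ⊤ = ⊥` in `EReal`, the dimension of `R` must be known to differ from `⊥`.
    rw [EReal.add_top_of_ne_bot FiniteFreeComplex.bot_lt_krullDimE.ne']
    exact le_top
  | bot =>
    have h1 : FiniteFreeComplex.infHAt (FiniteFreeComplex.dual F) p = ⊤ := by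
      refine EReal.eq_top_iff_forall_lt _ |>.2 fun y => ?_
      -- This `σ` makes the lower bound `-(d + σ)` equal to `y + 1`.
      refine lt_of_lt_of_le ?_ (FiniteFreeComplex.neg_le_infHAt_dual hF p hd.ge
        (σ := -(y + 1) - d) (h ▸ bot_le))
      rw [EReal.coe_lt_coe_iff]
      linarith
    simp [h1]
  | coe σ =>
    have h1 := FiniteFreeComplex.neg_le_infHAt_dual hF p hd.ge h.le
    calc _ ≤ FiniteFreeComplex.krullDimE (R ⧸ p.asIdeal) - ((-(d + σ) : ℝ) : EReal) :=
          EReal.sub_le_sub le_rfl h1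
      _ = FiniteFreeComplex.krullDimE (R ⧸ p.asIdeal) + d + σ := by
          rw [EReal.coe_neg, sub_eq_add_neg, neg_neg, EReal.coe_add, add_assoc]
          rfl
      _ ≤ _ := add_le_add (FiniteFreeComplex.krullDimE_quotient_add_height_le p hd.symm) le_rfl
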